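/- Let $P$ be a set of points and $H$ a set of halfspaces (closed or open, each bounded by an affine hyperplane) in $\mathbb{R}^d$. The incidence graph $G(P,H)$ is the bipartite graph with parts $P$ and $H$ in which $p\in P$ and $h\in H$ are adjacent if and only if $p\in h$. A graph is a point-halfspace incidence graph in $\mathbb{R}^d$ if it is isomorphic to $G(P,H)$ for some such $P$ and $H$. A graph is $K_{2,s}$-free if it does not contain the complete bipartite graph $K_{2,s}$ as a subgraph. Let $s\ge 2$ be an integer, and let $G$ be a $K_{2,s}$-free point-halfspace incidence graph in $\mathbb{R}^3$ with $n$ vertices. Then $G$ has at most $5(s-1)n$ edges. -/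

import Mathlib

/-- A halfspace of `ℝ^d`, closed or open: the set of points lying weakly, respectively strictly,
on one side of an affine hyperplane, whose normal vector `a` is nonzero. -/
def IsHalfspace {d : ℕ} (h : Set (EuclideanSpace ℝ (Fin d))) : Prop :=
  ∃ (a : EuclideanSpace ℝ (Fin d)) (c : ℝ), a ≠ 0 ∧
    (h = {x | c ≤ inner ℝ a x} ∨ h = {x | c < inner ℝ a x})

/-- The incidence graph `G(P, H)` of a set `P` of points and a set `H` of subsets of `E`: the
bipartite graph with parts `P` and `H` in which `p ∈ P` and `h ∈ H` are adjacent iff `p ∈ h`. -/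
def incidenceGraph {E : Type*} (P : Set E) (H : Set (Set E)) : SimpleGraph (P ⊕ H) where
  Adj
    | Sum.inl p, Sum.inr h => (p : E) ∈ (h : Set E)
    | Sum.inr h, Sum.inl p => (p : E) ∈ (h : Set E)
    | _, _ => False
  symm := ⟨by rintro (p | h) (q | k) hvw <;> exact hvw⟩
  loopless := ⟨by rintro (p | h) hv <;> exact hv⟩

/-- `G` is a point-halfspace incidence graph in `ℝ^d`: it is isomorphic to the incidence graph of
a set of points and a set of halfspaces of `ℝ^d`. -/
def IsPointHalfspaceIncidenceGraph {V : Type*} (d : ℕ) (G : SimpleGraph V) : Prop :=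
  ∃ (P : Set (EuclideanSpace ℝ (Fin d))) (H : Set (Set (EuclideanSpace ℝ (Fin d)))),
    (∀ h ∈ H, IsHalfspace h) ∧ Nonempty (G ≃g incidenceGraph P H)

/-!
The proof removes points one at a time. If in every nonempty finite set `S` of points there are a
point `i` and at most five other points such that each halfspace containing `i` and another point
of `S` contains one of these five, then removing `i` destroys at most `5 * (s - 1)` incidences,
because two points share at most `s - 1` halfspaces, besides those with halfspaces in which `i` is
the only point of `S`. Each halfspace is of the latter kind at most once, so the number of
incidences is at most `5 * (s - 1)` per point and one per halfspace (`sum_card_incidences_le`).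

Such a point exists (`exists_five_neighbors`) once the points are in general position, which a
perturbation that changes no incidence achieves (`exists_inGeneralPosition`). If some point is in
the convex hull of the others, Carathéodory's theorem gives few points having it in their convex
hull, and a halfspace containing it contains one of them. Otherwise the points are in convex
position, and there may be assumed to be at least four of them. A halfspace containing `i` and
another point then contains a neighbour of `i` in the edge graph of the polytope
(`exists_edge_of_pos`), so that a vertex of degree at most five is wanted. Instead of Euler's
formula the following count is used. Order the vertices by a coordinate `x`. Each facet, a triangle,
has a middle vertex, and a vertex `w` is the middle one of at most two facets, as the plane
`x = x w` cuts the polytope in a polygon with at most two edges at `w`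
(`card_facets_middle_le_two`). The first vertex is never a middle one. So there are fewer than twice
as many facets as vertices, and some vertex is on at most five facets. Each edge being on two facets
(`two_le_card_facets_of_edge`), this vertex has at most five neighbours.

Points are represented by homogeneous coordinate vectors in a four-dimensional space `V`, halfspaces
by the sign of linear functionals on `V`.
-/

/-! ### Supporting functionals of a finite configuration -/

section Facets

variable {ι V : Type*} [AddCommGroup V] [Module ℝ V]

/-- The configuration `v`, thought of as a list of homogeneous coordinate vectors of points of
three-dimensional space, is in general position: any four distinct members are linearly
independent. -/
def InGeneralPosition (v : ι → V) : Prop :=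
  ∀ g : Fin 4 → ι, Function.Injective g → LinearIndependent ℝ (v ∘ g)

/-- The functional `f` vanishes on `T` and is negative on the rest of `S`: its kernel is a plane
supporting the convex hull of `v '' S` exactly along the face with vertex set `T`. A one-point, a
two-point and a three-point `T` stand for a vertex, an edge and a facet. -/
def Supports (v : ι → V) (S T : Finset ι) (f : V →ₗ[ℝ] ℝ) : Prop :=
  (∀ i ∈ T, f (v i) = 0) ∧ ∀ i ∈ S, i ∉ T → f (v i) < 0

lemma injective_vec_four {a b c d : ι} (hab : a ≠ b) (hac : a ≠ c) (had : a ≠ d) (hbc : b ≠ c)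
    (hbd : b ≠ d) (hcd : c ≠ d) : Function.Injective ![a, b, c, d] := by
  intro i j h
  fin_cases i <;> fin_cases j <;> simp_all

lemma InGeneralPosition.exists_functional {v : ι → V} (hv : InGeneralPosition v)
    (hV : Module.finrank ℝ V = 4) {g : Fin 4 → ι} (hg : Function.Injective g) (c : Fin 4 → ℝ) :
    ∃ f : V →ₗ[ℝ] ℝ, ∀ k, f (v (g k)) = c k := by
  let b := basisOfLinearIndependentOfCardEqFinrank (hv g hg) (by simp [hV])
  refine ⟨b.constr ℝ c, fun k => ?_⟩
  have h : b k = v (g k) := by simp [b]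
  rw [← h, b.constr_basis]

lemma InGeneralPosition.eq_zero {v : ι → V} (hv : InGeneralPosition v)
    (hV : Module.finrank ℝ V = 4) {g : Fin 4 → ι} (hg : Function.Injective g) {f : V →ₗ[ℝ] ℝ}
    (hf : ∀ k, f (v (g k)) = 0) : f = 0 := by
  let b := basisOfLinearIndependentOfCardEqFinrank (hv g hg) (by simp [hV])
  refine b.ext fun k => ?_
  have h : b k = v (g k) := by simp [b]
  rw [h, hf k, LinearMap.zero_apply]

variable [DecidableEq ι]

/-- In convex position, a halfspace containing the vertex `i` and another vertex contains a vertex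
joined to `i` by an edge of the convex hull. -/
lemma exists_edge_of_pos {v : ι → V} {S : Finset ι}
    (hS : ∀ i ∈ S, ∃ e, Supports v S {i} e) {i j : ι} (hi : i ∈ S) (hj : j ∈ S) (hji : j ≠ i)
    {f : V →ₗ[ℝ] ℝ} (hfi : 0 < f (v i)) (hfj : 0 < f (v j)) :
    ∃ q ∈ S, q ≠ i ∧ 0 < f (v q) ∧ ∃ F, Supports v S {i, q} F := by
  obtain ⟨e, he0, he⟩ := hS i hi
  simp only [Finset.mem_singleton, forall_eq] at he0 he
  -- Rotate the halfspace towards the one touching the hull only in `i`; `q` is the last vertex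
  -- other than `i` to leave it.
  obtain ⟨q, hq, hmax⟩ := (S.erase i).exists_max_image (fun u => f (v u) / -e (v u))
    ⟨j, by simp [hj, hji]⟩
  simp only [Finset.mem_erase] at hq hmax
  obtain ⟨hqi, hqS⟩ := hq
  have heq := he q hqS hqi
  have hej := he j hj hji
  set s := f (v q) / -e (v q) with hs
  have hspos : 0 < s := lt_of_lt_of_le (div_pos hfj (by linarith)) (hmax j ⟨hji, hj⟩)
  have hfq : f (v q) = s * -e (v q) := by rw [hs, div_mul_cancel₀]; linarith
  obtain ⟨e', he0', he'⟩ := hS q hqS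
  simp only [Finset.mem_singleton, forall_eq] at he0' he'
  have hei := he' i hi hqi.symm
  -- Tilting towards the halfspace touching the hull only in `q` keeps `q` on the boundary and
  -- brings `i` down to it.
  set β := f (v i) / -e' (v i) with hβ
  have hβpos : 0 < β := div_pos hfi (by linarith)
  have hfi' : f (v i) = β * -e' (v i) := by rw [hβ, div_mul_cancel₀]; linarith
  refine ⟨q, hqS, hqi, by rw [hfq]; exact mul_pos hspos (by linarith), f + s • e + β • e', ?_, ?_⟩
  · intro k hk
    simp only [Finset.mem_insert, Finset.mem_singleton] at hk
    rcases hk with rfl | rfl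
    · simp only [LinearMap.add_apply, LinearMap.smul_apply, smul_eq_mul, he0, hfi']; ring
    · simp only [LinearMap.add_apply, LinearMap.smul_apply, smul_eq_mul, he0', hfq]; ring
  · intro u hu huT
    simp only [Finset.mem_insert, Finset.mem_singleton, not_or] at huT
    have h1 := hmax u ⟨huT.1, hu⟩
    have h2 := he u hu huT.1
    rw [div_le_iff₀ (by linarith)] at h1
    have h3 := mul_neg_of_pos_of_neg hβpos (he' u hu huT.2)
    simp only [LinearMap.add_apply, LinearMap.smul_apply, smul_eq_mul]
    linarith

/-- Rotating a supporting plane about an edge `p q`, in the direction given by `G`, until it meets a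
further vertex produces a facet. -/
lemma exists_facet_of_edge {v : ι → V} (hv : InGeneralPosition v)
    (hV : Module.finrank ℝ V = 4) {S : Finset ι} {p q : ι} (hpq : p ≠ q) {F G : V →ₗ[ℝ] ℝ}
    (hF : Supports v S {p, q} F) (hGp : G (v p) = 0) (hGq : G (v q) = 0) {r₀ r₁ : ι}
    (hr₀ : r₀ ∈ S) (hr₁ : r₁ ∈ S) (h₀ : 0 < G (v r₀)) (h₁ : G (v r₁) < 0) :
    ∃ r ∈ S, 0 < G (v r) ∧ ∃ F', Supports v S {p, q, r} F' := by
  obtain ⟨hF0, hF⟩ := hF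
  simp only [Finset.mem_insert, Finset.mem_singleton, forall_eq_or_imp, forall_eq, not_or]
    at hF0 hF
  have key : ∀ u ∈ S, G (v u) ≠ 0 → F (v u) < 0 := fun u hu h =>
    hF u hu ⟨by rintro rfl; exact h hGp, by rintro rfl; exact h hGq⟩
  obtain ⟨r, hr, hmax⟩ := (S.filter fun u => 0 < G (v u)).exists_max_image
    (fun u => G (v u) / -F (v u)) ⟨r₀, by simp [hr₀, h₀]⟩
  simp only [Finset.mem_filter] at hr hmax
  obtain ⟨hrS, hGr⟩ := hr
  have hFr := key r hrS hGr.ne'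
  -- The functional `(-F r) • G + (G r) • F` is the rotated one, without denominators.
  have hle : ∀ u ∈ S, u ≠ p → u ≠ q → -F (v r) * G (v u) + G (v r) * F (v u) ≤ 0 := by
    intro u hu hup huq
    have hFu := hF u hu ⟨hup, huq⟩
    rcases lt_or_ge 0 (G (v u)) with h | h
    · have h1 := hmax u ⟨hu, h⟩
      rw [div_le_div_iff₀ (by linarith) (by linarith)] at h1
      linarith
    · have h1 := mul_nonneg (neg_nonneg.2 hFr.le) (neg_nonneg.2 h)
      have h2 := mul_neg_of_pos_of_neg hGr hFu
      linarith
  have hne : (-F (v r)) • G + G (v r) • F ≠ 0 := by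
    intro h
    have h1 := DFunLike.congr_fun h (v r₁)
    simp only [LinearMap.add_apply, LinearMap.smul_apply, smul_eq_mul,
      LinearMap.zero_apply] at h1
    have h2 := mul_neg_of_pos_of_neg (neg_pos.2 hFr) h₁
    have h3 := mul_neg_of_pos_of_neg hGr (key r₁ hr₁ h₁.ne)
    linarith
  have hpr : p ≠ r := by rintro rfl; linarith
  have hqr : q ≠ r := by rintro rfl; linarith
  refine ⟨r, hrS, hGr, (-F (v r)) • G + G (v r) • F, ?_, ?_⟩
  · intro k hk
    simp only [Finset.mem_insert, Finset.mem_singleton] at hk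
    simp only [LinearMap.add_apply, LinearMap.smul_apply, smul_eq_mul]
    rcases hk with rfl | rfl | rfl
    · rw [hGp, hF0.1]; ring
    · rw [hGq, hF0.2]; ring
    · ring
  · intro u hu huT
    simp only [Finset.mem_insert, Finset.mem_singleton, not_or] at huT
    refine lt_of_le_of_ne (by simpa using hle u hu huT.1 huT.2.1) fun h0 => hne ?_
    refine hv.eq_zero hV (injective_vec_four hpq hpr (Ne.symm huT.1) hqr (Ne.symm huT.2.1)
      (Ne.symm huT.2.2)) fun k => ?_
    fin_cases k
    · simp [hGp, hF0.1]
    · simp [hGq, hF0.2]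
    · simp only [LinearMap.add_apply, LinearMap.smul_apply, smul_eq_mul]
      simp; ring
    · simpa using h0

/-- The facets of the convex hull of `v '' S`, as three-element subsets of `S`. -/
noncomputable def facets (v : ι → V) (S : Finset ι) : Finset (Finset ι) :=
  open Classical in (S.powersetCard 3).filter fun T => ∃ F, Supports v S T F

omit [DecidableEq ι] in
lemma mem_facets {v : ι → V} {S T : Finset ι} :
    T ∈ facets v S ↔ (T ⊆ S ∧ T.card = 3) ∧ ∃ F, Supports v S T F := by
  simp [facets, Finset.mem_powersetCard]

lemma two_le_card_facets_of_edge {v : ι → V} (hv : InGeneralPosition v)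
    (hV : Module.finrank ℝ V = 4) {S : Finset ι} (hS : 4 ≤ S.card) {p q : ι} (hp : p ∈ S)
    (hq : q ∈ S) (hpq : p ≠ q) {F : V →ₗ[ℝ] ℝ} (hF : Supports v S {p, q} F) :
    2 ≤ ((facets v S).filter fun T => p ∈ T ∧ q ∈ T).card := by
  have hcard : 1 < (S \ {p, q}).card := by
    have := Finset.le_card_sdiff ({p, q} : Finset ι) S
    have := Finset.card_le_two (a := p) (b := q)
    omega
  obtain ⟨r₀, h₀, r₁, h₁, hne⟩ := Finset.one_lt_card.1 hcard
  simp only [Finset.mem_sdiff, Finset.mem_insert, Finset.mem_singleton, not_or] at h₀ h₁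
  obtain ⟨G, hG⟩ := hv.exists_functional hV (injective_vec_four hpq (Ne.symm h₀.2.1)
    (Ne.symm h₁.2.1) (Ne.symm h₀.2.2) (Ne.symm h₁.2.2) hne) ![0, 0, 1, -1]
  have g0 : G (v p) = 0 := hG 0
  have g1 : G (v q) = 0 := hG 1
  have g2 : G (v r₀) = 1 := hG 2
  have g3 : G (v r₁) = -1 := hG 3
  obtain ⟨r, hr, hGr, F₁, hF₁⟩ := exists_facet_of_edge hv hV hpq hF g0 g1 h₀.1 h₁.1
    (by rw [g2]; norm_num) (by rw [g3]; norm_num)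
  obtain ⟨r', hr', hGr', F₂, hF₂⟩ := exists_facet_of_edge (G := -G) hv hV hpq hF (by simp [g0])
    (by simp [g1]) h₁.1 h₀.1 (by simp [g3]) (by simp [g2])
  rw [LinearMap.neg_apply, neg_pos] at hGr'
  have hpr : p ≠ r := by rintro rfl; linarith
  have hqr : q ≠ r := by rintro rfl; linarith
  have hpr' : p ≠ r' := by rintro rfl; linarith
  have hqr' : q ≠ r' := by rintro rfl; linarith
  have hrr' : r ≠ r' := by rintro rfl; linarith
  refine Finset.one_lt_card.2 ⟨{p, q, r}, ?_, {p, q, r'}, ?_, ?_⟩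
  · simp only [Finset.mem_filter, mem_facets]
    refine ⟨⟨⟨?_, Finset.card_eq_three.2 ⟨p, q, r, hpq, hpr, hqr, rfl⟩⟩, F₁, hF₁⟩, by simp⟩
    simp [Finset.insert_subset_iff, hp, hq, hr]
  · simp only [Finset.mem_filter, mem_facets]
    refine ⟨⟨⟨?_, Finset.card_eq_three.2 ⟨p, q, r', hpq, hpr', hqr', rfl⟩⟩, F₂, hF₂⟩, by simp⟩
    simp [Finset.insert_subset_iff, hp, hq, hr']
  · intro h
    have : r ∈ ({p, q, r'} : Finset ι) := h ▸ by simp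
    simp only [Finset.mem_insert, Finset.mem_singleton] at this
    rcases this with h | h | h
    · exact hpr h.symm
    · exact hqr h.symm
    · exact hrr' h

/-! ### The number of facets -/

/-- `w` is the middle one of the three points of `T`, in the order given by the functional `x`. -/
def IsMiddle (v : ι → V) (x : V →ₗ[ℝ] ℝ) (T : Finset ι) (w : ι) : Prop :=
  ∃ a c, T = {a, w, c} ∧ x (v a) < x (v w) ∧ x (v w) < x (v c)

lemma exists_isMiddle {v : ι → V} {x : V →ₗ[ℝ] ℝ} (hx : Function.Injective fun i => x (v i))
    {T : Finset ι} (hT : T.card = 3) : ∃ w ∈ T, IsMiddle v x T w := by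
  have hne : T.Nonempty := Finset.card_pos.1 (by omega)
  obtain ⟨a, ha, hmin⟩ := T.exists_min_image (fun i => x (v i)) hne
  obtain ⟨c, hc, hmax⟩ := T.exists_max_image (fun i => x (v i)) hne
  have hcard : 0 < (T \ {a, c}).card := by
    have := Finset.le_card_sdiff ({a, c} : Finset ι) T
    have := Finset.card_le_two (a := a) (b := c)
    omega
  obtain ⟨w, hw⟩ := Finset.card_pos.1 hcard
  simp only [Finset.mem_sdiff, Finset.mem_insert, Finset.mem_singleton, not_or] at hw
  have haw : x (v a) < x (v w) := lt_of_le_of_ne (hmin w hw.1) fun h => hw.2.1 (hx h).symm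
  have hwc : x (v w) < x (v c) := lt_of_le_of_ne (hmax w hw.1) fun h => hw.2.2 (hx h)
  refine ⟨w, hw.1, a, c, (Finset.eq_of_subset_of_card_le ?_ ?_).symm, haw, hwc⟩
  · simp [Finset.insert_subset_iff, ha, hw.1, hc]
  · rw [hT, Finset.card_eq_three.2 ⟨a, w, c, ?_, ?_, ?_, rfl⟩]
    · rintro rfl; exact lt_irrefl _ haw
    · rintro rfl; exact lt_asymm haw hwc
    · rintro rfl; exact lt_irrefl _ hwc

/-- Used in contrapositive form: of three vectors of a plane, not each one can span a line that
has both others strictly on the same side. A nontrivial linear relation would have coefficients of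
pairwise opposite signs. -/
lemma linearIndependent_of_exposed {u : Fin 3 → V} {f : Fin 3 → V →ₗ[ℝ] ℝ}
    (h0 : ∀ i, f i (u i) = 0) (hneg : ∀ i j, i ≠ j → f i (u j) < 0) :
    LinearIndependent ℝ u := by
  rw [Fintype.linearIndependent_iff]
  intro g hg
  have sign : ∀ a b s t : ℝ, s < 0 → t < 0 → a * s + b * t = 0 →
      (0 < a → b < 0) ∧ (a < 0 → 0 < b) ∧ (a = 0 → b = 0) := by
    intro a b s t hs ht h
    refine ⟨fun ha => ?_, fun ha => ?_, ?_⟩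
    · by_contra! hb
      have := mul_neg_of_pos_of_neg ha hs
      have := mul_nonpos_of_nonneg_of_nonpos hb ht.le
      linarith
    · by_contra! hb
      have := mul_pos_of_neg_of_neg ha hs
      have := mul_nonneg_of_nonpos_of_nonpos hb ht.le
      linarith
    · rintro rfl
      have : b * t = 0 := by linarith
      exact (mul_eq_zero.1 this).resolve_right ht.ne
  have app : ∀ i, ∑ j, g j * f i (u j) = 0 := by
    intro i
    simpa using congrArg (f i) hg
  have e0 := app 0
  have e1 := app 1
  have e2 := app 2
  simp only [Fin.sum_univ_three, h0, mul_zero, zero_add, add_zero] at e0 e1 e2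
  have s12 := sign _ _ _ _ (hneg 0 1 (by decide)) (hneg 0 2 (by decide)) e0
  have s02 := sign _ _ _ _ (hneg 1 0 (by decide)) (hneg 1 2 (by decide)) e1
  have s01 := sign _ _ _ _ (hneg 2 0 (by decide)) (hneg 2 1 (by decide)) e2
  have hz : g 0 = 0 := by
    rcases lt_trichotomy (g 0) 0 with h | h | h
    · exact absurd (s12.1 (s01.2.1 h)) (lt_asymm (s02.2.1 h))
    · exact h
    · exact absurd (s12.2.1 (s01.1 h)) (lt_asymm (s02.1 h))
  intro i
  fin_cases i
  · exact hz
  · exact s01.2.2 hz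
  · exact s02.2.2 hz

lemma finrank_ker_prod_eq_two [FiniteDimensional ℝ V] (hV : Module.finrank ℝ V = 4)
    {ω x : V →ₗ[ℝ] ℝ} {κ : ℝ} (hκ : κ ≠ 0) {a b : V} (ha : ω a = κ) (hb : ω b = κ)
    (hab : x a ≠ x b) : Module.finrank ℝ (LinearMap.ker (ω.prod x)) = 2 := by
  have hsurj : LinearMap.range (ω.prod x) = ⊤ := by
    rw [LinearMap.range_eq_top]
    rintro ⟨s, t⟩
    have hd : x a - x b ≠ 0 := sub_ne_zero.2 hab
    refine ⟨((t - s / κ * x b) / (x a - x b)) • (a - b) + (s / κ) • b, ?_⟩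
    refine Prod.ext ?_ ?_
    · simp [ha, hb, hκ]
    · change x _ = t
      simp only [map_add, map_smul, map_sub, smul_eq_mul]
      rw [div_mul_cancel₀ _ hd]
      ring
  have := (ω.prod x).finrank_range_add_finrank_ker
  rw [hsurj, finrank_top, Module.finrank_prod, Module.finrank_self, hV] at this
  omega

/-- A point is the middle vertex of at most two facets: the plane `x = const` through `w` cuts the
hull in a convex polygon, and each such facet in an edge of the polygon at `w`. -/
lemma card_facets_middle_le_two [FiniteDimensional ℝ V] (hV : Module.finrank ℝ V = 4) {v : ι → V}
    {ω x : V →ₗ[ℝ] ℝ} {κ : ℝ} (hκ : κ ≠ 0) (hω : ∀ i, ω (v i) = κ) {S : Finset ι} {w : ι}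
    {A : Finset (Finset ι)} (hA : ∀ T ∈ A, T ∈ facets v S ∧ IsMiddle v x T w) : A.card ≤ 2 := by
  by_contra! hcard
  obtain ⟨T₀, h0, T₁, h1, T₂, h2, h01, h02, h12⟩ := Finset.two_lt_card.1 hcard
  set T : Fin 3 → Finset ι := ![T₀, T₁, T₂] with hTdef
  have hTA : ∀ i, T i ∈ A := by intro i; fin_cases i <;> simp [hTdef, h0, h1, h2]
  have hTne : ∀ i j, i ≠ j → T i ≠ T j := by
    intro i j hij
    fin_cases i <;> fin_cases j <;> simp_all [Ne.symm]
  have hT3 : ∀ i, (T i).card = 3 := fun i => (mem_facets.1 (hA _ (hTA i)).1).1.2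
  have hTS : ∀ i, T i ⊆ S := fun i => (mem_facets.1 (hA _ (hTA i)).1).1.1
  choose f hf0 hfneg using fun i => (mem_facets.1 (hA _ (hTA i)).1).2
  choose a c hT hlt hgt using fun i => (hA _ (hTA i)).2
  -- `u i` points from `w` towards the point where the side opposite to `w` crosses the slice.
  set u : Fin 3 → V := fun i => (x (v (c i)) - x (v w)) • v (a i) +
    (x (v w) - x (v (a i))) • v (c i) - (x (v (c i)) - x (v (a i))) • v w with hu
  have hmem : ∀ i, a i ∈ T i ∧ w ∈ T i ∧ c i ∈ T i := by
    intro i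
    rw [hT i]; simp
  have hle : ∀ i, ∀ k ∈ S, f i (v k) ≤ 0 := by
    intro i k hk
    by_cases h : k ∈ T i
    · exact (hf0 i k h).le
    · exact (hfneg i k hk h).le
  have hind : LinearIndependent ℝ u := by
    refine linearIndependent_of_exposed (f := f) (fun i => ?_) fun i j hij => ?_
    · simp [hu, hf0 i _ (hmem i).1, hf0 i _ (hmem i).2.1, hf0 i _ (hmem i).2.2]
    · have hw := hf0 i w (hmem i).2.1
      have p1 : 0 < x (v (c j)) - x (v w) := sub_pos.2 (hgt j)
      have p2 : 0 < x (v w) - x (v (a j)) := sub_pos.2 (hlt j)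
      have l1 := hle i _ (hTS j (hmem j).1)
      have l2 := hle i _ (hTS j (hmem j).2.2)
      have hor : f i (v (a j)) < 0 ∨ f i (v (c j)) < 0 := by
        by_contra! hcon
        have m1 : a j ∈ T i := by
          by_contra h
          exact absurd (hfneg i _ (hTS j (hmem j).1) h) (not_lt.2 hcon.1)
        have m2 : c j ∈ T i := by
          by_contra h
          exact absurd (hfneg i _ (hTS j (hmem j).2.2) h) (not_lt.2 hcon.2)
        refine hTne j i hij.symm (Finset.eq_of_subset_of_card_le ?_ (by rw [hT3, hT3]))
        conv_lhs => rw [hT j]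
        simp [Finset.insert_subset_iff, m1, m2, (hmem i).2.1]
      simp only [hu, map_sub, map_add, map_smul, smul_eq_mul, hw, mul_zero, sub_zero]
      rcases hor with h | h
      · exact add_neg_of_neg_of_nonpos (mul_neg_of_pos_of_neg p1 h)
          (mul_nonpos_of_nonneg_of_nonpos p2.le l2)
      · exact add_neg_of_nonpos_of_neg (mul_nonpos_of_nonneg_of_nonpos p1.le l1)
          (mul_neg_of_pos_of_neg p2 h)
  have hker : ∀ i, u i ∈ LinearMap.ker (ω.prod x) := by
    intro i
    rw [LinearMap.mem_ker]
    refine Prod.ext ?_ ?_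
    · change ω (u i) = 0
      simp only [hu, map_sub, map_add, map_smul, smul_eq_mul, hω]
      ring
    · change x (u i) = 0
      simp only [hu, map_sub, map_add, map_smul, smul_eq_mul]
      ring
  have hind' : LinearIndependent ℝ fun i => (⟨u i, hker i⟩ : LinearMap.ker (ω.prod x)) :=
    LinearIndependent.of_comp (LinearMap.ker (ω.prod x)).subtype hind
  have h3 := hind'.fintype_card_le_finrank
  rw [finrank_ker_prod_eq_two hV hκ (hω (a 0)) (hω w) (hlt 0).ne] at h3
  simp at h3

lemma card_facets_le [FiniteDimensional ℝ V] (hV : Module.finrank ℝ V = 4) {v : ι → V}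
    {ω x : V →ₗ[ℝ] ℝ} {κ : ℝ} (hκ : κ ≠ 0) (hω : ∀ i, ω (v i) = κ)
    (hx : Function.Injective fun i => x (v i)) {S : Finset ι} (hS : S.Nonempty) :
    (facets v S).card ≤ 2 * (S.card - 1) := by
  classical
  -- The leftmost point is never a middle vertex.
  obtain ⟨m, hm, hmin⟩ := S.exists_min_image (fun i => x (v i)) hS
  have := Finset.card_mul_le_card_mul (s := facets v S) (t := S.erase m) (m := 1) (n := 2)
    (fun T w => IsMiddle v x T w) ?_ ?_
  · rw [Finset.card_erase_of_mem hm] at this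
    omega
  · intro T hT
    have hT' := (mem_facets.1 hT).1
    obtain ⟨w, hw, hmid⟩ := exists_isMiddle hx hT'.2
    refine Finset.card_pos.2 ⟨w, ?_⟩
    rw [Finset.mem_bipartiteAbove, Finset.mem_erase]
    refine ⟨⟨?_, hT'.1 hw⟩, hmid⟩
    rintro rfl
    obtain ⟨a, c, rfl, hlt, -⟩ := hmid
    exact absurd hlt (not_lt.2 (hmin a (hT'.1 (by simp))))
  · intro w _
    refine card_facets_middle_le_two hV hκ hω (S := S) (w := w) (x := x) fun T hT => ?_
    simpa [Finset.mem_bipartiteBelow] using hT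

lemma exists_mem_card_facets_le_five [FiniteDimensional ℝ V] (hV : Module.finrank ℝ V = 4)
    {v : ι → V} {ω x : V →ₗ[ℝ] ℝ} {κ : ℝ} (hκ : κ ≠ 0) (hω : ∀ i, ω (v i) = κ)
    (hx : Function.Injective fun i => x (v i)) {S : Finset ι} (hS : S.Nonempty) :
    ∃ i ∈ S, ((facets v S).filter fun T => i ∈ T).card ≤ 5 := by
  by_contra! hcon
  have := Finset.card_mul_le_card_mul (s := S) (t := facets v S) (m := 6) (n := 3)
    (fun i T => i ∈ T) (fun i hi => ?_) (fun T hT => ?_)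
  · have := card_facets_le hV hκ hω hx hS
    have := hS.card_pos
    omega
  · exact hcon i hi
  · rw [← (mem_facets.1 hT).1.2]
    exact Finset.card_le_card fun i hi => (Finset.mem_bipartiteBelow _).1 hi |>.2

/-! ### A point with at most five neighbours -/

lemma exists_five_neighbors_of_convexPosition [FiniteDimensional ℝ V]
    (hV : Module.finrank ℝ V = 4) {v : ι → V} (hv : InGeneralPosition v)
    {ω x : V →ₗ[ℝ] ℝ} {κ : ℝ} (hκ : κ ≠ 0) (hω : ∀ i, ω (v i) = κ)
    (hx : Function.Injective fun i => x (v i)) {S : Finset ι} (hcard : 4 ≤ S.card)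
    (hS : ∀ i ∈ S, ∃ e, Supports v S {i} e) :
    ∃ i ∈ S, ∃ N ⊆ S.erase i, N.card ≤ 5 ∧ ∀ f : V →ₗ[ℝ] ℝ, 0 < f (v i) →
      (∃ j ∈ S.erase i, 0 < f (v j)) → ∃ j ∈ N, 0 < f (v j) := by
  classical
  obtain ⟨i, hi, h5⟩ := exists_mem_card_facets_le_five hV hκ hω hx (S := S)
    (Finset.card_pos.1 (by omega))
  refine ⟨i, hi, (S.erase i).filter fun q => ∃ F, Supports v S {i, q} F,
    Finset.filter_subset _ _, ?_, ?_⟩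
  · have := Finset.card_mul_le_card_mul
      (s := (S.erase i).filter fun q => ∃ F, Supports v S {i, q} F)
      (t := (facets v S).filter fun T => i ∈ T) (m := 2) (n := 2)
      (fun q T => q ∈ T) (fun q hq => ?_) (fun T hT => ?_)
    · omega
    · simp only [Finset.mem_filter, Finset.mem_erase] at hq
      obtain ⟨⟨hqi, hqS⟩, F, hF⟩ := hq
      refine (two_le_card_facets_of_edge hv hV hcard hi hqS hqi.symm hF).trans
        (Finset.card_le_card fun T hT => ?_)
      simp only [Finset.mem_filter] at hT
      simp [Finset.mem_bipartiteAbove, hT]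
    · simp only [Finset.mem_filter] at hT
      have h2 : (T.erase i).card = 2 := by
        rw [Finset.card_erase_of_mem hT.2, (mem_facets.1 hT.1).1.2]
      rw [← h2]
      refine Finset.card_le_card fun q hq => ?_
      simp only [Finset.mem_bipartiteBelow, Finset.mem_filter, Finset.mem_erase] at hq
      exact Finset.mem_erase.2 ⟨hq.1.1.1, hq.2⟩
  · rintro f hfi ⟨j, hj, hfj⟩
    rw [Finset.mem_erase] at hj
    obtain ⟨q, hq, hqi, hfq, hF⟩ := exists_edge_of_pos hS hi hj.2 hj.1 hfi hfj
    exact ⟨q, by simp [hq, hqi, hF], hfq⟩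

end Facets

section Neighbors

variable {ι V : Type*} [DecidableEq ι] [NormedAddCommGroup V] [NormedSpace ℝ V]

lemma exists_supports_singleton {v : ι → V} {ω : V →ₗ[ℝ] ℝ} {κ : ℝ} (hκ : κ ≠ 0)
    (hω : ∀ i, ω (v i) = κ) {S : Finset ι} {i : ι}
    (hi : v i ∉ convexHull ℝ (v '' (S.erase i : Finset ι))) : ∃ e, Supports v S {i} e := by
  have hfin : (v '' (S.erase i : Finset ι)).Finite := (Finset.finite_toSet _).image _
  obtain ⟨f, s, hlt, hs⟩ := geometric_hahn_banach_closed_point (convex_convexHull ℝ _)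
    (hfin.isCompact_convexHull ℝ).isClosed hi
  refine ⟨f.toLinearMap - (f (v i) / κ) • ω, ?_, ?_⟩
  · simp [hω, hκ]
  · intro j hj hji
    have h := hlt (v j) (subset_convexHull ℝ _
      ⟨j, by simpa [hj] using hji, rfl⟩)
    simp only [LinearMap.sub_apply, LinearMap.smul_apply, hω, smul_eq_mul,
      div_mul_cancel₀ _ hκ, ContinuousLinearMap.coe_coe]
    linarith

/-- By Carathéodory's theorem a point of the convex hull of the others lies in the hull of few of
them, and every halfspace containing it contains one of these few. -/
lemma exists_five_of_mem_convexHull [FiniteDimensional ℝ V] (hV : Module.finrank ℝ V = 4)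
    {v : ι → V} {S : Finset ι} {i : ι}
    (hi : v i ∈ convexHull ℝ (v '' (S.erase i : Finset ι))) :
    ∃ N ⊆ S.erase i, N.card ≤ 5 ∧ ∀ f : V →ₗ[ℝ] ℝ, 0 < f (v i) → ∃ j ∈ N, 0 < f (v j) := by
  classical
  rw [convexHull_eq_union] at hi
  simp only [Set.mem_iUnion] at hi
  obtain ⟨t, hts, hind, hmem⟩ := hi
  obtain ⟨N, hN, hNt, hinj⟩ : ∃ N ⊆ S.erase i, N.image v = t ∧ N.card = t.card := by
    obtain ⟨N, hNsub, hbij⟩ := (Set.SurjOn.exists_bijOn_subset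
      (show Set.SurjOn v (S.erase i : Finset ι) t from hts))
    have hNfin : N.Finite := (Finset.finite_toSet _).subset hNsub
    refine ⟨hNfin.toFinset, by intro k hk; exact hNsub (by simpa using hk), ?_, ?_⟩
    · apply Finset.coe_injective
      simpa using hbij.image_eq
    · have h : hNfin.toFinset.image v = t := by
        apply Finset.coe_injective
        simpa using hbij.image_eq
      rw [← h, Finset.card_image_of_injOn]
      simpa using hbij.injOn
  refine ⟨N, hN, ?_, fun f hf => ?_⟩
  · have := hind.card_le_finrank_succ
    have h2 := Submodule.finrank_le (vectorSpan ℝ (Set.range ((↑) : t → V)))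
    rw [Fintype.card_coe] at this
    omega
  · by_contra! hcon
    have hsub : (t : Set V) ⊆ {y | f y ≤ 0} := by
      rw [← hNt]
      intro y hy
      obtain ⟨j, hj, rfl⟩ := Finset.mem_image.1 (Finset.mem_coe.1 hy)
      exact hcon j hj
    have := convexHull_min hsub (convex_halfSpace_le f.isLinear 0) hmem
    exact absurd hf (not_lt.2 this)

/-- A finite set of points in general position contains a point `i` with at most five neighbours,
meaning that every halfspace containing `i` and another point of the set contains one of them. -/
theorem exists_five_neighbors [FiniteDimensional ℝ V] (hV : Module.finrank ℝ V = 4) {v : ι → V}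
    (hv : InGeneralPosition v) {ω x : V →ₗ[ℝ] ℝ} {κ : ℝ} (hκ : κ ≠ 0) (hω : ∀ i, ω (v i) = κ)
    (hx : Function.Injective fun i => x (v i)) {S : Finset ι} (hS : S.Nonempty) :
    ∃ i ∈ S, ∃ N ⊆ S.erase i, N.card ≤ 5 ∧ ∀ f : V →ₗ[ℝ] ℝ, 0 < f (v i) →
      (∃ j ∈ S.erase i, 0 < f (v j)) → ∃ j ∈ N, 0 < f (v j) := by
  by_cases hconv : ∃ i ∈ S, v i ∈ convexHull ℝ (v '' (S.erase i : Finset ι))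
  · obtain ⟨i, hi, hmem⟩ := hconv
    obtain ⟨N, hN, h5, h⟩ := exists_five_of_mem_convexHull hV hmem
    exact ⟨i, hi, N, hN, h5, fun f hf _ => h f hf⟩
  · push Not at hconv
    rcases lt_or_ge S.card 4 with hlt | hge
    · obtain ⟨i, hi⟩ := hS
      refine ⟨i, hi, S.erase i, subset_rfl, ?_, fun f _ h => h⟩
      rw [Finset.card_erase_of_mem hi]
      omega
    · exact exists_five_neighbors_of_convexPosition hV hv hκ hω hx hge
        fun i hi => exists_supports_singleton hκ hω (hconv i hi)

end Neighbors

/-! ### Perturbation to general position -/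

section Perturbation

open Filter Topology Polynomial

lemma eventually_nhdsGT_of_cofinite {q : ℝ → Prop} (h : ∀ᶠ ε in cofinite, q ε) (a : ℝ) :
    ∀ᶠ ε in 𝓝[>] a, q ε :=
  (h.filter_mono (nhdsNE_le_cofinite a)).filter_mono
    (nhdsWithin_mono _ fun _ h => ne_of_gt h)

lemma eventually_det_add_smul_ne_zero {n : ℕ} (A B : Matrix (Fin n) (Fin n) ℝ) (hA : A.det ≠ 0) :
    ∀ᶠ ε : ℝ in 𝓝[>] 0, (B + ε • A).det ≠ 0 := by
  set P : ℝ[X] := ((X : ℝ[X]) • A.map C + B.map C).det with hP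
  have hP0 : P ≠ 0 := by
    intro h
    have := Polynomial.coeff_det_X_add_C_card A B
    rw [← hP, h, coeff_zero] at this
    exact hA this.symm
  have hfin : ∀ᶠ ε : ℝ in cofinite, ¬ P.IsRoot ε :=
    Set.Finite.eventually_cofinite_notMem (Polynomial.finite_setOfPred_isRoot hP0)
  refine (eventually_nhdsGT_of_cofinite hfin 0).mono fun ε hε h => hε ?_
  rw [IsRoot.def, hP, ← coe_evalRingHom, RingHom.map_det, ← h]
  congr 1
  ext i j
  simp [Matrix.add_apply, add_comm (B i j), mul_comm ε]

/-- Finitely many points of three-dimensional space, in homogeneous coordinates, can be moved to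
general position and to distinct first coordinates without crossing any of finitely many planes
that avoid them. -/
lemma exists_inGeneralPosition {ι β : Type*} [Finite ι] [Finite β] (p : ι → Fin 4 → ℝ)
    (hp : ∀ i, p i 0 = 1) (f : β → (Fin 4 → ℝ) →ₗ[ℝ] ℝ) (hf : ∀ b i, f b (p i) ≠ 0) :
    ∃ (v : ι → Fin 4 → ℝ) (κ : ℝ), κ ≠ 0 ∧ (∀ i, v i 0 = κ) ∧ InGeneralPosition v ∧
      (Function.Injective fun i => v i 1) ∧ ∀ b i, 0 < f b (v i) ↔ 0 < f b (p i) := by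
  obtain ⟨t, ht⟩ : ∃ t : ι → ℝ, Function.Injective t :=
    ⟨fun i => ((Finite.equivFin ι i : ℕ) : ℝ), fun i j h => (Finite.equivFin ι).injective
      (Fin.ext (Nat.cast_injective h))⟩
  -- Move along the moment curve, on which any four points are in general position.
  set w : ι → Fin 4 → ℝ := fun i k => t i ^ (k : ℕ) with hw
  have hgp : ∀ᶠ ε : ℝ in 𝓝[>] 0, ∀ g : Fin 4 → ι, Function.Injective g →
      LinearIndependent ℝ ((fun i => p i + ε • w i) ∘ g) := by
    rw [eventually_all]
    intro g
    by_cases hg : Function.Injective g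
    · have hdet : (Matrix.vandermonde (t ∘ g)).det ≠ 0 :=
        Matrix.det_vandermonde_ne_zero_iff.2 (ht.comp hg)
      refine (eventually_det_add_smul_ne_zero _ (Matrix.of fun k => p (g k)) hdet).mono
        fun ε hε _ => ?_
      exact Matrix.linearIndependent_rows_of_det_ne_zero hε
    · exact Eventually.of_forall fun _ h => absurd h hg
  have hx : ∀ᶠ ε : ℝ in 𝓝[>] 0, ∀ i j, i ≠ j → p i 1 + ε * t i ≠ p j 1 + ε * t j := by
    rw [eventually_all]
    intro i
    rw [eventually_all]
    intro j
    by_cases hij : i = j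
    · exact Eventually.of_forall fun _ h => absurd hij h
    have hne : t i - t j ≠ 0 := sub_ne_zero.2 (ht.ne hij)
    have hfin : ∀ᶠ ε : ℝ in cofinite, ε ∉ ({(p j 1 - p i 1) / (t i - t j)} : Set ℝ) :=
      Set.Finite.eventually_cofinite_notMem (Set.finite_singleton _)
    refine (eventually_nhdsGT_of_cofinite hfin 0).mono fun ε hε _ h => hε ?_
    rw [Set.mem_singleton_iff, eq_div_iff hne]
    linarith
  have hsign : ∀ᶠ ε : ℝ in 𝓝[>] 0, ∀ b i, 0 < f b (p i + ε • w i) ↔ 0 < f b (p i) := by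
    rw [eventually_all]
    intro b
    rw [eventually_all]
    intro i
    have hlim : Tendsto (fun ε : ℝ => f b (p i + ε • w i)) (𝓝[>] 0) (𝓝 (f b (p i))) := by
      have hc : Continuous fun ε : ℝ => f b (p i) + ε * f b (w i) := by fun_prop
      simpa using (hc.tendsto 0).mono_left nhdsWithin_le_nhds
    rcases (hf b i).lt_or_gt with h | h
    · filter_upwards [hlim.eventually_lt_const h] with ε hε
      exact iff_of_false (not_lt.2 hε.le) (not_lt.2 h.le)
    · filter_upwards [hlim.eventually_const_lt h] with ε hε
      exact iff_of_true hε h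
  obtain ⟨ε, ⟨⟨hgp, hx⟩, hsign⟩, hε⟩ :=
    (((hgp.and hx).and hsign).and self_mem_nhdsWithin).exists
  replace hε : 0 < ε := hε
  refine ⟨fun i => p i + ε • w i, 1 + ε, by positivity, fun i => by simp [hw, hp], hgp,
    fun i j h => ?_, hsign⟩
  by_contra hij
  exact hx i j hij (by simpa [hw] using h)

end Perturbation

section Homogeneous

open Topology

/-- Homogeneous coordinates of a point of `ℝ³`. -/
noncomputable def homogenize (p : EuclideanSpace ℝ (Fin 3)) : Fin 4 → ℝ :=
  Fin.cons 1 fun k => p k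

/-- Membership of finitely many points in a halfspace, closed or open, is the sign of a linear
functional of the homogeneous coordinates that does not vanish at these points. -/
lemma IsHalfspace.exists_functional {h : Set (EuclideanSpace ℝ (Fin 3))} (hh : IsHalfspace h)
    {P : Set (EuclideanSpace ℝ (Fin 3))} (hP : P.Finite) :
    ∃ f : (Fin 4 → ℝ) →ₗ[ℝ] ℝ, ∀ p ∈ P, f (homogenize p) ≠ 0 ∧ (p ∈ h ↔ 0 < f (homogenize p)) := by
  obtain ⟨a, c, -, hac⟩ := hh
  -- Shift the bounding plane off the points: outwards if `h` is closed, inwards if it is open.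
  obtain ⟨c', hc'⟩ : ∃ c' : ℝ, ∀ p ∈ P, inner ℝ a p ≠ c' ∧ (p ∈ h ↔ c' < inner ℝ a p) := by
    rcases hac with rfl | rfl
    · have : ∀ᶠ c' in 𝓝[<] c, ∀ p ∈ P,
          inner ℝ a p ≠ c' ∧ (p ∈ {x | c ≤ inner ℝ a x} ↔ c' < inner ℝ a p) := by
        rw [Filter.eventually_all_finite hP]
        intro p _
        rcases lt_or_ge (inner ℝ a p) c with hlt | hge
        · filter_upwards [Ioo_mem_nhdsLT hlt] with c' hc'
          exact ⟨hc'.1.ne, iff_of_false (not_le.2 hlt) (not_lt.2 hc'.1.le)⟩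
        · filter_upwards [self_mem_nhdsWithin] with c' hc'
          have := lt_of_lt_of_le (Set.mem_Iio.1 hc') hge
          exact ⟨this.ne', iff_of_true hge this⟩
      exact this.exists
    · have : ∀ᶠ c' in 𝓝[>] c, ∀ p ∈ P,
          inner ℝ a p ≠ c' ∧ (p ∈ {x | c < inner ℝ a x} ↔ c' < inner ℝ a p) := by
        rw [Filter.eventually_all_finite hP]
        intro p _
        rcases lt_or_ge c (inner ℝ a p) with hlt | hge
        · filter_upwards [Ioo_mem_nhdsGT hlt] with c' hc'
          exact ⟨hc'.2.ne', iff_of_true hlt hc'.2⟩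
        · filter_upwards [self_mem_nhdsWithin] with c' hc'
          have := lt_of_le_of_lt hge (Set.mem_Ioi.1 hc')
          exact ⟨this.ne, iff_of_false (not_lt.2 hge) (not_lt.2 this.le)⟩
      exact this.exists
  let f : (Fin 4 → ℝ) →ₗ[ℝ] ℝ :=
    (innerₛₗ ℝ a) ∘ₗ (WithLp.linearEquiv 2 ℝ (Fin 3 → ℝ)).symm.toLinearMap ∘ₗ
      LinearMap.funLeft ℝ ℝ Fin.succ - c' • LinearMap.proj 0
  refine ⟨f, fun p hp => ?_⟩
  have key : f (homogenize p) = inner ℝ a p - c' := by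
    have h1 : WithLp.toLp 2 (homogenize p ∘ Fin.succ) = p := by
      ext k; simp [homogenize]
    have h2 : homogenize p 0 = 1 := rfl
    simp [f, LinearMap.funLeft, h2, h1]
  rw [key, sub_pos]
  exact ⟨sub_ne_zero.2 (hc' p hp).1, (hc' p hp).2⟩

end Homogeneous

/-! ### Counting incidences -/

section Counting

open Finset

variable {A B : Type*} [DecidableEq A] [Fintype B] (I : A → B → Prop) [∀ a, DecidablePred (I a)]

/-- If every nonempty set of points has a member all of whose non-private blocks pass through one
of `k` other members, and two points share at most `m` blocks, the points can be removed one at a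
time: each removal destroys at most `k * m` incidences and those with blocks that become empty. -/
lemma sum_card_incidences_le {k m : ℕ}
    (hI : ∀ a a', a ≠ a' → (univ.filter fun b => I a b ∧ I a' b).card ≤ m)
    (hdeg : ∀ S : Finset A, S.Nonempty → ∃ i ∈ S, ∃ N ⊆ S.erase i, N.card ≤ k ∧
      ∀ b, I i b → (∃ j ∈ S.erase i, I j b) → ∃ j ∈ N, I j b) (S : Finset A) :
    ∑ a ∈ S, (univ.filter fun b => I a b).card ≤
      k * m * S.card + (univ.filter fun b => ∃ a ∈ S, I a b).card := by
  classical
  induction S using Finset.strongInduction with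
  | H S ih =>
    rcases S.eq_empty_or_nonempty with rfl | hne
    · simp
    obtain ⟨i, hi, N, hN, hNk, h⟩ := hdeg S hne
    have ih' := ih (S.erase i) (erase_ssubset hi)
    rw [← add_sum_erase S _ hi, ← card_erase_add_one hi]
    have hsplit : univ.filter (fun b => I i b) ⊆
        (N.biUnion fun j => univ.filter fun b => I i b ∧ I j b) ∪
          ((univ.filter fun b => ∃ a ∈ S, I a b) \
            univ.filter fun b => ∃ a ∈ S.erase i, I a b) := by
      intro b hb
      simp only [mem_filter, mem_univ, true_and] at hb
      by_cases hex : ∃ j ∈ S.erase i, I j b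
      · obtain ⟨j, hj, hjb⟩ := h b hb hex
        exact mem_union_left _ (mem_biUnion.2 ⟨j, hj, by simp [hb, hjb]⟩)
      · refine mem_union_right _ (mem_sdiff.2 ⟨?_, ?_⟩)
        · simpa using ⟨i, hi, hb⟩
        · rw [mem_filter]
          exact fun hc => hex hc.2
    have hsub : (univ.filter fun b => ∃ a ∈ S.erase i, I a b) ⊆
        univ.filter fun b => ∃ a ∈ S, I a b := by
      intro b hb
      obtain ⟨a, ha, hab⟩ := (mem_filter.1 hb).2
      exact mem_filter.2 ⟨mem_univ _, a, mem_of_mem_erase ha, hab⟩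
    have h1 := (card_le_card hsplit).trans (card_union_le _ _)
    have h2 : (N.biUnion fun j => univ.filter fun b => I i b ∧ I j b).card ≤ k * m :=
      (card_biUnion_le_card_mul _ _ _ fun j hj =>
        hI i j (ne_of_mem_erase (hN hj)).symm).trans (Nat.mul_le_mul_right m hNk)
    have h3 := card_sdiff_add_card_eq_card hsub
    rw [mul_add, mul_one]
    omega

end Counting

lemma card_common_neighbors_le {E : Type*} {P : Set E} {H : Set (Set E)} [Fintype H] {s : ℕ}
    (hs : 2 ≤ s) (hfree : (completeBipartiteGraph (Fin 2) (Fin s)).Free (incidenceGraph P H))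
    [∀ p : P, DecidablePred fun h : H => (p : E) ∈ (h : Set E)] {p q : P} (hpq : p ≠ q) :
    (Finset.univ.filter fun h : H => (p : E) ∈ (h : Set E) ∧ (q : E) ∈ (h : Set E)).card
      ≤ s - 1 := by
  by_contra! hcon
  set C := Finset.univ.filter fun h : H => (p : E) ∈ (h : Set E) ∧ (q : E) ∈ (h : Set E) with hC
  have hcard : Fintype.card (Fin s) ≤ Fintype.card C := by
    rw [Fintype.card_fin, Fintype.card_coe]
    omega
  obtain ⟨g⟩ := Function.Embedding.nonempty_of_card_le hcard
  have hg : ∀ k, (p : E) ∈ ((g k : H) : Set E) ∧ (q : E) ∈ ((g k : H) : Set E) := by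
    intro k
    exact (Finset.mem_filter.1 (g k).2).2
  have hmem : ∀ (i : Fin 2) k, ((![p, q] i : P) : E) ∈ ((g k : H) : Set E) := by
    intro i k
    fin_cases i
    · exact (hg k).1
    · exact (hg k).2
  refine hfree ⟨⟨⟨Sum.map ![p, q] fun k => (g k : H), ?_⟩, ?_⟩⟩
  · rintro (i | k) (j | l) hab
    · simp at hab
    · exact hmem i l
    · exact hmem j k
    · simp at hab
  · refine Sum.map_injective.2 ⟨?_, Subtype.val_injective.comp g.injective⟩
    intro i j hij
    fin_cases i <;> fin_cases j <;> simp_all [Ne.symm]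

lemma card_edgeSet_incidenceGraph_le {E : Type*} {P : Set E} {H : Set (Set E)} [Fintype P]
    [Fintype H] [∀ p : P, DecidablePred fun h : H => (p : E) ∈ (h : Set E)] :
    Nat.card (incidenceGraph P H).edgeSet ≤
      ∑ p : P, (Finset.univ.filter fun h : H => (p : E) ∈ (h : Set E)).card := by
  classical
  rw [← Finset.card_sigma, Nat.card_coe_set_eq]
  refine le_trans ?_ (Finset.card_image_le
    (f := fun x : (_ : P) × H => s((Sum.inl x.1 : P ⊕ H), Sum.inr x.2)))
  rw [← Set.ncard_coe_finset]
  refine Set.ncard_le_ncard (fun e => ?_) (Finset.finite_toSet _)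
  induction e using Sym2.ind with
  | _ x y =>
    rw [SimpleGraph.mem_edgeSet]
    intro hxy
    rw [Finset.mem_coe, Finset.mem_image]
    have mem : ∀ (p : P) (h : H), (p : E) ∈ (h : Set E) → (⟨p, h⟩ : (_ : P) × H) ∈
        Finset.univ.sigma fun p : P => Finset.univ.filter fun h : H => (p : E) ∈ (h : Set E) :=
      fun p h hph => Finset.mem_sigma.2
        ⟨Finset.mem_univ _, Finset.mem_filter.2 ⟨Finset.mem_univ _, hph⟩⟩
    rcases x with p | h <;> rcases y with q | k
    · exact hxy.elim
    · exact ⟨⟨p, k⟩, mem p k hxy, rfl⟩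
    · exact ⟨⟨q, h⟩, mem q h hxy, Sym2.eq_swap⟩
    · exact hxy.elim

theorem mainTheorem12 {V : Type*} [Fintype V] (G : SimpleGraph V) [Fintype G.edgeSet]
    (s n : ℕ) (hs : 2 ≤ s) (hn : Fintype.card V = n)
    (hG : IsPointHalfspaceIncidenceGraph 3 G)
    (hfree : (completeBipartiteGraph (Fin 2) (Fin s)).Free G) :
    G.edgeFinset.card ≤ 5 * (s - 1) * n := by
  classical
  obtain ⟨P, H, hH, ⟨e⟩⟩ := hG
  have hfin : Finite (P ⊕ H) := Finite.of_equiv V e.toEquiv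
  have hPfin : Finite P := Finite.of_injective (Sum.inl : P → P ⊕ H) Sum.inl_injective
  have hHfin : Finite H := Finite.of_injective (Sum.inr : H → P ⊕ H) Sum.inr_injective
  let _ := Fintype.ofFinite P
  let _ := Fintype.ofFinite H
  have hfree' : (completeBipartiteGraph (Fin 2) (Fin s)).Free (incidenceGraph P H) :=
    fun hc => hfree (hc.trans ⟨e.symm.toCopy⟩)
  choose f hf using fun h : H => (hH h h.2).exists_functional (Set.toFinite P)
  obtain ⟨v, κ, hκ, hω, hv, hx, hsign⟩ := exists_inGeneralPosition
    (fun p : P => homogenize p) (fun _ => rfl) f fun h p => (hf h p p.2).1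
  have hiff : ∀ (p : P) (h : H), (p : EuclideanSpace ℝ (Fin 3)) ∈
      (h : Set (EuclideanSpace ℝ (Fin 3))) ↔ 0 < f h (v p) := fun p h =>
    (hf h p p.2).2.trans (hsign h p).symm
  have hcount := sum_card_incidences_le (k := 5) (m := s - 1)
    (fun (p : P) (h : H) => (p : EuclideanSpace ℝ (Fin 3)) ∈
      (h : Set (EuclideanSpace ℝ (Fin 3))))
    (fun p q hpq => card_common_neighbors_le hs hfree' hpq) (fun S hS => ?_) Finset.univ
  · have hedge : G.edgeFinset.card = Nat.card (incidenceGraph P H).edgeSet := by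
      rw [SimpleGraph.edgeFinset_card, ← Nat.card_eq_fintype_card]
      exact Nat.card_congr e.mapEdgeSet
    have hV : n = Fintype.card P + Fintype.card H := by
      rw [← hn, Fintype.card_congr e.toEquiv, Fintype.card_sum]
    have hB := (Finset.univ.filter fun h : H => ∃ p ∈ Finset.univ (α := P),
      (p : EuclideanSpace ℝ (Fin 3)) ∈ (h : Set (EuclideanSpace ℝ (Fin 3)))).card_le_univ
    have hE := card_edgeSet_incidenceGraph_le (P := P) (H := H)
    have hle : Fintype.card H ≤ 5 * (s - 1) * Fintype.card H :=
      Nat.le_mul_of_pos_left _ (by omega)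
    rw [Finset.card_univ] at hcount
    rw [hedge, hV, mul_add]
    omega
  · obtain ⟨i, hi, N, hN, h5, h⟩ := exists_five_neighbors (ω := LinearMap.proj 0)
      (x := LinearMap.proj 1) (by simp) hv hκ hω hx hS
    refine ⟨i, hi, N, hN, h5, fun b hb => ?_⟩
    simp only [hiff] at hb ⊢
    exact h (f b) hb
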